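/- Fix $d\in\mathbb N$, $T>0$, $p\ge 1$ and let $V=\mathbb R^{d+1}$, with coordinates indexed by $0,1,\dots,d$. Let $T((V))=\prod_{k\ge 0}V^{\otimes k}$ be the algebra of tensor series over $V$, with the topology of coordinatewise convergence. A $p$-rough path is a continuous map $X=(1,X^1,X^2,\dots)\colon\{(s,t):0\le s\le t\le T\}\to T((V))$ such that $X_{s,t}=X_{s,u}\otimes X_{u,t}$ for all $s\le u\le t$, and $\sup_{\mathcal D}\sum_i\|X^k_{t_i,t_{i+1}}\|^{p/k}<\infty$ for all $k\ge 1$, where $\mathcal D$ ranges over the finite subdivisions $(t_i)$ of $[0,T]$. The set $\Omega_p(V)$ of $p$-rough paths carries the $p$-variation metric $$d_p(X,Y)=\max_{1\le k\le\lfloor p\rfloor}\ \sup_{\mathcal D}\Big(\sum_i\|X^k_{t_i,t_{i+1}}-Y^k_{t_i,t_{i+1}}\|^{p/k}\Big)^{1/p}.$$ Let $G\Omega_p$ be the space of all $X$ in the closure of $\Omega_1(V)$ in $(\Omega_p(V),d_p)$ whose $0$-th coordinate is time, that is, $X^{1,(0)}_{s,t}=t-s$ for all $s\le t$. It is equipped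 with $d_p$ and its Borel $\sigma$-algebra. The signature of $X\in G\Omega_p$ is $S(X)=X_{0,T}\in T((V))$. We write $S^m(X)\in V^{\otimes m}$ for its $m$-th level and $S^J(X)\in\mathbb R$ for its coordinate at a multi-index $J$ in the letters $0,\dots,d$. Let $\mathcal M$ be the set of Borel probability measures $\mu$ on $G\Omega_p$ with $\int\|S^m\|\,d\mu<\infty$ for every $m\in\mathbb N$. For $\mu\in\mathcal M$ the expected signature $\mu(S)\in T((V))$ has coordinates $\mu(S^J)=\int S^J\,d\mu$. **Lemma.** Let $(\mu_n)$ be a sequence in $\mathcal M$ that is uniformly integrable, i.e. for every $m\in\mathbb N$, $$\sup_{n}\int\|S^m\|\,\mathbf 1_{\{\|S^m\|\ge K\}}\,d\mu_n\longrightarrow 0\qquad(K\to\infty),$$ and let $\mu$ be a Borel probability measure on $G\Omega_p$. (i) If $\mu_n\Rightarrow\mu$ weakly, then $\mu\in\mathcal M$ and $\mu_n(S)\to\mu(S)$ pointwise, i.e. $\mu_n(S^J)\to\mu(S^J)$ for every multi-index $J$. (ii) If $(\mu_n)$ is tight, $\mu\in\mathcal M$, and $\mu$ is characterised by its expected signature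 in the sense that for all $\nu\in\mathcal M$, $\mu(S)=\nu(S)$ implies $\mu=\nu$, then $\mu_n(S)\to\mu(S)$ pointwise implies $\mu_n\Rightarrow\mu$ weakly. -/

import Mathlib

open MeasureTheory Filter Topology
open scoped ENNReal

noncomputable section

namespace RoughSig

/-- Words (multi-indices) in the letters `0, …, d`; the letter `0` stands for time. -/
abbrev Word (d : ℕ) := List (Fin (d + 1))

/-- The space `T((V))` of formal tensor series over `V = ℝ^{d+1}`, in coordinates: the coefficient
of `e_{j₁} ⊗ ⋯ ⊗ e_{jₖ}` is the value at the word `[j₁, …, jₖ]`. As a function space it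
carries the topology of coordinatewise convergence. -/
abbrev TensorSeries (d : ℕ) := Word d → ℝ

/-- The level `V^{⊗k}` with the Hilbert-Schmidt (Euclidean) norm. -/
abbrev TensorLevel (d k : ℕ) := EuclideanSpace ℝ (Fin k → Fin (d + 1))

/-- The product `⊗` of `T((V))` (concatenation product):
`(a ⊗ b)_w = ∑_{w = uv} a_u b_v`. -/
def TensorSeries.tmul {d : ℕ} (a b : TensorSeries d) : TensorSeries d :=
  fun w => ∑ i ∈ Finset.range (w.length + 1), a (w.take i) * b (w.drop i)

/-- The component of a tensor series in `V^{⊗k}`. -/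
def TensorSeries.level {d : ℕ} (a : TensorSeries d) (k : ℕ) : TensorLevel d k :=
  WithLp.toLp 2 fun J => a (List.ofFn J)

/-- The simplex `{(s, t) : 0 ≤ s ≤ t ≤ T}`. -/
abbrev Triangle (T : ℝ) := {q : Set.Icc (0 : ℝ) T × Set.Icc (0 : ℝ) T // q.1 ≤ q.2}

/-- The point `(s, t)` of the simplex. -/
abbrev Triangle.mk {T : ℝ} (s t : Set.Icc (0 : ℝ) T) (h : s ≤ t) : Triangle T := ⟨(s, t), h⟩

/-- A finite subdivision `0 = t₀ ≤ t₁ ≤ ⋯ ≤ tₙ = T` of `[0, T]`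
(the values beyond the index `n` are irrelevant). -/
structure Subdivision (T : ℝ) where
  n : ℕ
  pt : ℕ → Set.Icc (0 : ℝ) T
  mono : Monotone pt
  pt_zero : (pt 0 : ℝ) = 0
  pt_last : (pt n : ℝ) = T

/-- The `i`-th interval `(tᵢ, tᵢ₊₁)` of a subdivision. -/
def Subdivision.interval {T : ℝ} (D : Subdivision T) (i : ℕ) : Triangle T :=
  Triangle.mk (D.pt i) (D.pt (i + 1)) (D.mono (Nat.le_succ i))

/-- `sup_D ∑ᵢ ‖F(tᵢ, tᵢ₊₁)‖^q`, the supremum being over finite subdivisions of `[0, T]`. -/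
def variation {T : ℝ} {E : Type*} [NormedAddCommGroup E] (q : ℝ) (F : Triangle T → E) : ℝ≥0∞ :=
  ⨆ D : Subdivision T, ∑ i ∈ Finset.range D.n, ‖F (D.interval i)‖ₑ ^ q

/-- A `p`-rough path on `[0, T]` in `V = ℝ^{d+1}`: a continuous map `(s, t) ↦ X_{s,t}` into
`T((V))` with zeroth level `1`, which satisfies Chen's identity and has finite `p`-variation,
`sup_D ∑ ‖X^k‖^{p/k} < ∞` for every level `k ≥ 1`. -/
structure RoughPath (d : ℕ) (p T : ℝ) where
  toFun : Triangle T → TensorSeries d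
  continuous_toFun : Continuous toFun
  zeroth : ∀ q, toFun q [] = 1
  chen : ∀ (s u t : Set.Icc (0 : ℝ) T) (hsu : s ≤ u) (hut : u ≤ t),
    toFun (Triangle.mk s t (hsu.trans hut)) =
      (toFun (Triangle.mk s u hsu)).tmul (toFun (Triangle.mk u t hut))
  finite_variation : ∀ k : ℕ, 1 ≤ k → variation (p / k) (fun q => (toFun q).level k) < ∞

namespace RoughPath

variable {d : ℕ} {p T : ℝ}

/-- The `p`-variation distance
`d_p(X, Y) = max_{1 ≤ k ≤ ⌊p⌋} sup_D (∑ ‖X^k - Y^k‖^{p/k})^{1/p}`. -/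
def pvarDist (X Y : RoughPath d p T) : ℝ≥0∞ :=
  ⨆ k ∈ Finset.Icc 1 ⌊p⌋₊,
    (variation (p / k) (fun q => (X.toFun q).level k - (Y.toFun q).level k)) ^ (1 / p)

end RoughPath

/-- Minkowski's inequality for the variation. -/
theorem variation_add_rpow_le {T : ℝ} {E : Type*} [NormedAddCommGroup E] {q : ℝ} (hq : 1 ≤ q)
    (F G : Triangle T → E) :
    (variation q (fun x => F x + G x)) ^ (1 / q) ≤
      (variation q F) ^ (1 / q) + (variation q G) ^ (1 / q) := by
  have hq0 : 0 < q := by linarith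
  rw [one_div, ENNReal.rpow_inv_le_iff hq0]
  refine iSup_le fun D => ?_
  rw [← ENNReal.rpow_inv_le_iff hq0, ← one_div]
  calc (∑ i ∈ Finset.range D.n, ‖F (D.interval i) + G (D.interval i)‖ₑ ^ q) ^ (1 / q)
      ≤ (∑ i ∈ Finset.range D.n, (‖F (D.interval i)‖ₑ + ‖G (D.interval i)‖ₑ) ^ q) ^ (1 / q) := by
        gcongr
        exact enorm_add_le _ _
    _ ≤ (∑ i ∈ Finset.range D.n, ‖F (D.interval i)‖ₑ ^ q) ^ (1 / q) +
          (∑ i ∈ Finset.range D.n, ‖G (D.interval i)‖ₑ ^ q) ^ (1 / q) :=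
        ENNReal.Lp_add_le _ _ _ hq
    _ ≤ _ := by
        gcongr
        · exact le_iSup (fun D : Subdivision T =>
            ∑ i ∈ Finset.range D.n, ‖F (D.interval i)‖ₑ ^ q) D
        · exact le_iSup (fun D : Subdivision T =>
            ∑ i ∈ Finset.range D.n, ‖G (D.interval i)‖ₑ ^ q) D

/-- The space `Ω_p(V)` with the `p`-variation metric. (Distinct rough paths have positive
distance, by the uniqueness of the extension of a rough path from its first `⌊p⌋` levels;
this is not needed to define the topology.) -/
instance {d : ℕ} {p T : ℝ} [hp : Fact (1 ≤ p)] : PseudoEMetricSpace (RoughPath d p T) where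
  edist := RoughPath.pvarDist
  edist_self X := by
    have hp0 : 0 < p := by linarith [hp.out]
    simp only [RoughPath.pvarDist, ENNReal.iSup_eq_zero]
    intro k hk
    have hk1 : 0 < (k : ℝ) := by exact_mod_cast (Finset.mem_Icc.1 hk).1
    simp [variation, ENNReal.zero_rpow_of_pos (div_pos hp0 hk1),
      ENNReal.zero_rpow_of_pos (inv_pos.2 hp0)]
  edist_comm X Y := by
    simp only [RoughPath.pvarDist, variation]
    simp_rw [fun (k : ℕ) (q : Triangle T) =>
      enorm_sub_rev ((X.toFun q).level k) ((Y.toFun q).level k)]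
  edist_triangle X Y Z := by
    have hp0 : 0 < p := by linarith [hp.out]
    refine iSup₂_le fun k hk => ?_
    have hk1 : (1 : ℝ) ≤ (k : ℝ) := by exact_mod_cast (Finset.mem_Icc.1 hk).1
    have hk0 : (0 : ℝ) < k := by linarith
    have hkp : (k : ℝ) ≤ p :=
      (Nat.cast_le.2 (Finset.mem_Icc.1 hk).2).trans (Nat.floor_le hp0.le)
    have hq : 1 ≤ p / k := (one_le_div hk0).2 hkp
    have key (v : ℝ≥0∞) : v ^ (1 / p) = (v ^ (1 / (p / k))) ^ (1 / (k : ℝ)) := by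
      rw [← ENNReal.rpow_mul]
      congr 1
      field_simp
    have hX := le_iSup₂ (f := fun (k : ℕ) (_ : k ∈ Finset.Icc 1 ⌊p⌋₊) =>
      (variation (p / k) (fun q => (X.toFun q).level k - (Y.toFun q).level k)) ^ (1 / p)) k hk
    have hY := le_iSup₂ (f := fun (k : ℕ) (_ : k ∈ Finset.Icc 1 ⌊p⌋₊) =>
      (variation (p / k) (fun q => (Y.toFun q).level k - (Z.toFun q).level k)) ^ (1 / p)) k hk
    refine le_trans ?_ (add_le_add hX hY)
    have h := variation_add_rpow_le hq (fun q => (X.toFun q).level k - (Y.toFun q).level k)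
      (fun q => (Y.toFun q).level k - (Z.toFun q).level k)
    simp only [sub_add_sub_cancel] at h
    simp only [key]
    refine (ENNReal.rpow_le_rpow h (by positivity)).trans ?_
    exact ENNReal.rpow_add_le_add_rpow _ _ (by positivity) ((div_le_one hk0).2 hk1)

/-- The subset `Ω_1(V)` of `Ω_p(V)`: rough paths of finite `1`-variation, which are the
signatures of continuous paths of bounded variation. -/
def boundedVariationPaths (d : ℕ) (p T : ℝ) : Set (RoughPath d p T) :=
  {X | ∀ k : ℕ, 1 ≤ k → variation (1 / (k : ℝ)) (fun q => (X.toFun q).level k) < ∞}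

/-- The geometric `p`-rough paths `x = (x⁰, …, x^d)` on `[0, T]`, i.e. the closure of `Ω_1(V)` in
`Ω_p(V)`, whose zeroth component is time, `x⁰(t) = t`. -/
def geometricRoughPaths (d : ℕ) (p T : ℝ) [Fact (1 ≤ p)] : Set (RoughPath d p T) :=
  {X | X ∈ closure (boundedVariationPaths d p T) ∧
    ∀ q : Triangle T, X.toFun q [0] = (q.1.2 : ℝ) - (q.1.1 : ℝ)}

/-- The space `GΩ_p`, with the `p`-variation metric. -/
def GeomRoughPath (d : ℕ) (p T : ℝ) [Fact (1 ≤ p)] : Type := ↥(geometricRoughPaths d p T)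

section

variable {d : ℕ} {p T : ℝ} [Fact (1 ≤ p)]

instance : PseudoEMetricSpace (GeomRoughPath d p T) :=
  inferInstanceAs (PseudoEMetricSpace ↥(geometricRoughPaths d p T))

instance : MeasurableSpace (GeomRoughPath d p T) := borel _

instance : BorelSpace (GeomRoughPath d p T) := ⟨rfl⟩

/-- The signature `S(X) = X_{0,T}` of a rough path on `[0, T]`, where `T > 0`. -/
def sig (hT : 0 < T) (X : GeomRoughPath d p T) : TensorSeries d :=
  X.1.toFun (Triangle.mk ⟨0, le_rfl, hT.le⟩ ⟨T, hT.le, le_rfl⟩ hT.le)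

/-- The class `𝓜` of laws with finite signature moments: for every `m`, the `m`-th level of the
signature is integrable, i.e. its norm has a finite integral. -/
def HasSigMoments (hT : 0 < T) (μ : ProbabilityMeasure (GeomRoughPath d p T)) : Prop :=
  ∀ m : ℕ, Integrable (fun X => (sig hT X).level m) (μ : Measure (GeomRoughPath d p T))

/-- The expected signature, coordinate by coordinate. -/
def expectedSig (hT : 0 < T) (μ : ProbabilityMeasure (GeomRoughPath d p T)) : TensorSeries d :=
  fun w => ∫ X, sig hT X w ∂(μ : Measure (GeomRoughPath d p T))

/-- Uniform integrability of a sequence of laws: for every `m`,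
`sup_n μ_n(‖S^m‖ 1_{‖S^m‖ ≥ K}) → 0` as `K → ∞`. -/
def UnifIntegrableSig (hT : 0 < T) (μs : ℕ → ProbabilityMeasure (GeomRoughPath d p T)) : Prop :=
  ∀ m : ℕ, Tendsto (fun K : ℝ => ⨆ n : ℕ,
    ∫⁻ X in {X | K ≤ ‖(sig hT X).level m‖}, ‖(sig hT X).level m‖ₑ
      ∂(μs n : Measure (GeomRoughPath d p T))) atTop (𝓝 0)

/-- The law `μ` is characterised, within `𝓜`, by its expected signature. -/
def CharacterisedByExpectedSig (hT : 0 < T) (μ : ProbabilityMeasure (GeomRoughPath d p T)) :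
    Prop :=
  ∀ ν : ProbabilityMeasure (GeomRoughPath d p T), HasSigMoments hT ν →
    expectedSig hT μ = expectedSig hT ν → μ = ν

end

end RoughSig

end

/-!
Everything rests on the continuity of `X ↦ S^w(X)` in the `p`-variation metric for every word `w`,
although the metric sees only the levels up to `⌊p⌋`.

Given that, the first assertion is the usual truncation argument: integrals of bounded continuous
functions converge, and uniform integrability makes the truncation error small uniformly along the
sequence, hence also under the limit (`integrable_and_tendsto_integral`). For the second assertion,
the space is Hausdorff because the continuous coordinates separate points, so Prokhorov's theorem
makes the sequence relatively compact. A cluster point is a limit along an ultrafilter; by the first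
assertion along that ultrafilter it belongs to `𝓜` and has the same expected signature as `μ`, so
it is `μ`. A relatively compact sequence with a single cluster point converges.

Continuity (`RoughPath.continuous_coord`) goes by induction on the length `k` of `w`. For `k ≤ ⌊p⌋`
it is immediate from the metric. For `k > ⌊p⌋`, Chen's identity shows that
`X^w_{s,t} - ∑ᵢ X^w_{tᵢ,tᵢ₊₁}` is a polynomial in shorter coordinates at the points of the
partition, hence continuous. It remains to make the sum small along one partition, uniformly for
`Y` near `X`. Fix `p < p' < ⌊p⌋ + 1` and let `ω` be the `p`-variation control of `Y`. On short
intervals `|Y^v| ≤ η^{|v|}` for `|v| ≤ ⌊p⌋`, and interpolation with `|Y^v| ≤ ω^{|v|/p}` gives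
`|Y^v| ≤ (η^{p'-p} ω)^{|v|/p'}`. Lyons' extension estimate (`RoughPath.exists_extension_const`)
propagates this bound to all levels, up to constants, and the sum over the partition is
`O((η^{p'-p} ω(0, T))^{k/p'})`. Working with `p'` avoids the continuity of the control `ω`. The
extension estimate itself is a sewing argument (`enorm_sub_sum_le`): the additivity defect of
`X^w` is a sum of products of shorter coordinates, of order `ω^{k/p'}` with `k/p' > 1`, and the
sums of `X^w` over fine partitions vanish.
-/

open scoped NNReal

namespace RoughSig

/-! ### Superadditive controls and sewing along chains -/

/-- A control in the sense of rough path theory, without any continuity requirement: a function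
of intervals with `ω(s, u) + ω(u, t) ≤ ω(s, t)`. Only the values at `s ≤ t` matter. -/
def Superadditive {ι : Type*} [Preorder ι] (ω : ι → ι → ℝ≥0∞) : Prop :=
  ∀ ⦃s u t⦄, s ≤ u → u ≤ t → ω s u + ω u t ≤ ω s t

namespace Superadditive

variable {ι : Type*} [Preorder ι] {ω : ι → ι → ℝ≥0∞}

theorem mono (hω : Superadditive ω) {s s' t' t : ι} (h₁ : s ≤ s') (h₂ : s' ≤ t') (h₃ : t' ≤ t) :
    ω s' t' ≤ ω s t :=
  calc ω s' t' ≤ ω s s' + ω s' t' := le_add_self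
    _ ≤ ω s t' := hω h₁ h₂
    _ ≤ ω s t' + ω t' t := le_self_add
    _ ≤ ω s t := hω (h₁.trans h₂) h₃

theorem self_eq_zero (hω : Superadditive ω) {s : ι} (hs : ω s s ≠ ∞) : ω s s = 0 := by
  have h := hω (le_refl s) (le_refl s)
  by_contra h0
  exact absurd h (not_le.2 (ENNReal.lt_add_right hs h0))

theorem const_mul (hω : Superadditive ω) (c : ℝ≥0∞) : Superadditive fun s t => c * ω s t := by
  intro s u t h₁ h₂
  simp only [← mul_add]
  gcongr
  exact hω h₁ h₂

theorem sum_rpow_le (hω : Superadditive ω) {θ : ℝ} (hθ : 1 ≤ θ) {u : ℕ → ι} (hu : Monotone u)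
    (n : ℕ) : ∑ i ∈ Finset.range n, ω (u i) (u (i + 1)) ^ θ ≤ ω (u 0) (u n) ^ θ := by
  induction n with
  | zero => simp
  | succ n ih =>
    rw [Finset.sum_range_succ]
    calc _ ≤ ω (u 0) (u n) ^ θ + ω (u n) (u (n + 1)) ^ θ := by gcongr
      _ ≤ (ω (u 0) (u n) + ω (u n) (u (n + 1))) ^ θ := ENNReal.add_rpow_le_rpow_add _ _ hθ
      _ ≤ _ := by
        gcongr
        exact hω (hu (Nat.zero_le n)) (hu (Nat.le_succ n))

end Superadditive

/-- The smallest superadditive majorant of `f`: the supremum of `∑ f(uᵢ, uᵢ₊₁)` over the finite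
chains `u₀ ≤ ⋯ ≤ uₙ` in `[s, t]`. -/
noncomputable def chainSup {ι : Type*} [Preorder ι] (f : ι → ι → ℝ≥0∞) (s t : ι) : ℝ≥0∞ :=
  ⨆ c : {c : ℕ × (ℕ → ι) // Monotone c.2 ∧ s ≤ c.2 0 ∧ c.2 c.1 ≤ t},
    ∑ i ∈ Finset.range c.1.1, f (c.1.2 i) (c.1.2 (i + 1))

section ChainSup

variable {ι : Type*} [Preorder ι] (f : ι → ι → ℝ≥0∞)

theorem sum_le_chainSup {s t : ι} {n : ℕ} {u : ℕ → ι} (hu : Monotone u) (h₀ : s ≤ u 0)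
    (h₁ : u n ≤ t) : ∑ i ∈ Finset.range n, f (u i) (u (i + 1)) ≤ chainSup f s t :=
  le_iSup (fun c : {c : ℕ × (ℕ → ι) // Monotone c.2 ∧ s ≤ c.2 0 ∧ c.2 c.1 ≤ t} =>
    ∑ i ∈ Finset.range c.1.1, f (c.1.2 i) (c.1.2 (i + 1))) ⟨(n, u), hu, h₀, h₁⟩

theorem le_chainSup {s t : ι} (h : s ≤ t) : f s t ≤ chainSup f s t := by
  have hu : Monotone fun i : ℕ => if i = 0 then s else t := by
    intro i j hij
    dsimp only
    split_ifs <;> first | exact le_rfl | exact h | omega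
  simpa using sum_le_chainSup f (n := 1) hu (s := s) (t := t) (by simp) (by simp)

theorem superadditive_chainSup : Superadditive (chainSup f) := by
  intro s m t hsm hmt
  have h₁ : Nonempty {c : ℕ × (ℕ → ι) // Monotone c.2 ∧ s ≤ c.2 0 ∧ c.2 c.1 ≤ m} :=
    ⟨⟨(0, fun _ => s), monotone_const, le_rfl, hsm⟩⟩
  have h₂ : Nonempty {c : ℕ × (ℕ → ι) // Monotone c.2 ∧ m ≤ c.2 0 ∧ c.2 c.1 ≤ t} :=
    ⟨⟨(0, fun _ => m), monotone_const, le_rfl, hmt⟩⟩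
  refine ENNReal.iSup_add_iSup_le ?_
  rintro ⟨⟨n, u⟩, hu, hu0, hun⟩ ⟨⟨k, v⟩, hv, hv0, hvk⟩
  dsimp only at *
  have hw : Monotone fun i : ℕ => if i ≤ n then u i else v (i - (n + 1)) := by
    intro i j hij
    dsimp only
    split_ifs with hi hj hj
    · exact hu hij
    · exact ((hu hi).trans hun).trans (hv0.trans (hv (Nat.zero_le _)))
    · omega
    · exact hv (by omega)
  refine le_trans ?_ (sum_le_chainSup f (n := n + 1 + k) hw (s := s) (t := t) (by simpa) ?_)
  · rw [Finset.sum_range_add, Finset.sum_range_succ]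
    refine add_le_add (le_trans (Finset.sum_le_sum fun i hi => ?_) le_self_add)
      (Finset.sum_le_sum fun i _ => ?_)
    · have := Finset.mem_range.1 hi
      rw [if_pos (by omega), if_pos (by omega)]
    · rw [if_neg (by omega), if_neg (by omega)]
      exact le_of_eq (by congr 2 <;> omega)
  · rw [if_neg (by omega)]
    simpa using hvk

end ChainSup

/-- The geometric series constant of the sewing lemma, in the form in which the bisection
argument uses it. -/
theorem exists_sewing_const {θ : ℝ} (hθ : 1 < θ) :
    ∃ K : ℝ≥0, ∀ A w : ℝ≥0∞,
      2 * (A * w ^ θ) + 2 * (K * A * (w / 2) ^ θ) ≤ K * A * w ^ θ := by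
  have h2 : (2 : ℝ≥0) ^ (1 - θ) < 1 :=
    NNReal.rpow_lt_one_of_one_lt_of_neg (by norm_num) (by linarith)
  set r : ℝ≥0 := 2 ^ (1 - θ) with hr
  refine ⟨2 / (1 - r), fun A w => ?_⟩
  have hK : (2 + (2 / (1 - r)) * r : ℝ≥0) = 2 / (1 - r) := by
    have h0 : (1 - r) ≠ 0 := (tsub_pos_of_lt h2).ne'
    rw [div_mul_eq_mul_div, eq_div_iff h0, add_mul, div_mul_cancel₀ _ h0, ← mul_add,
      tsub_add_cancel_of_le h2.le, mul_one]
  have hw : 2 * (w / 2) ^ θ = (r : ℝ≥0∞) * w ^ θ := by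
    rw [ENNReal.div_rpow_of_nonneg _ _ (by linarith), hr,
      ENNReal.coe_rpow_of_ne_zero two_ne_zero, ENNReal.coe_ofNat, sub_eq_add_neg,
      ENNReal.rpow_add _ _ two_ne_zero ENNReal.ofNat_ne_top, ENNReal.rpow_one, ENNReal.rpow_neg,
      div_eq_mul_inv]
    ring
  have hK' : (2 : ℝ≥0∞) + ((2 / (1 - r) : ℝ≥0) : ℝ≥0∞) * r = ((2 / (1 - r) : ℝ≥0) : ℝ≥0∞) := by
    exact_mod_cast hK
  refine le_of_eq ?_
  calc _ = 2 * (A * w ^ θ) + ((2 / (1 - r) : ℝ≥0) : ℝ≥0∞) * A * (2 * (w / 2) ^ θ) := by ring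
    _ = (2 + ((2 / (1 - r) : ℝ≥0) : ℝ≥0∞) * r) * A * w ^ θ := by rw [hw]; ring
    _ = _ := by rw [hK']

/-- **Sewing along a chain.** If the additivity defect of `F` is at most `A ω^θ` with `θ > 1`, then
`F` differs from its sum over a chain by at most `K A ω^θ`, uniformly in the length of the chain.
The chain is cut at the index where `ω` passes half of its value, which costs two defects and
leaves two chains with control at most `ω / 2`. -/
theorem enorm_sub_sum_le {E : Type*} [NormedAddCommGroup E] {θ : ℝ} (hθ : 1 < θ) {K : ℝ≥0}
    (hK : ∀ A w : ℝ≥0∞, 2 * (A * w ^ θ) + 2 * (K * A * (w / 2) ^ θ) ≤ K * A * w ^ θ)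
    {F : ℕ → ℕ → E} {ω : ℕ → ℕ → ℝ≥0∞} (hω : Superadditive ω)
    (hfin : ∀ a b, a ≤ b → ω a b ≠ ∞) (hF : ∀ a, F a a = 0) {A : ℝ≥0∞}
    (hdef : ∀ a u b, a ≤ u → u ≤ b → ‖F a b - F a u - F u b‖ₑ ≤ A * ω a b ^ θ) (n : ℕ) :
    ∀ a b, b = a + n → ‖F a b - ∑ i ∈ Finset.Ico a b, F i (i + 1)‖ₑ ≤ K * A * ω a b ^ θ := by
  classical
  induction n using Nat.strong_induction_on with
  | _ n ih =>
    rintro a b hb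
    rcases Nat.eq_zero_or_pos n with rfl | hn
    · simp only [add_zero] at hb
      simp [hb, hF]
    let P : ℕ → Prop := fun m => a ≤ m ∧ ω a m ≤ ω a b / 2
    have hPa : P a := ⟨le_rfl, by simp [hω.self_eq_zero (hfin a a le_rfl)]⟩
    obtain ⟨m, hmb, hPm, hmax⟩ : ∃ m, m + 1 ≤ b ∧ P m ∧ ∀ k, m < k → k ≤ b - 1 → ¬ P k :=
      ⟨Nat.findGreatest P (b - 1), by have := Nat.findGreatest_le (P := P) (b - 1); omega,
        Nat.findGreatest_spec (m := a) (by omega) hPa,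
        fun k hk hkb => Nat.findGreatest_is_greatest hk hkb⟩
    have ham := hPm.1
    have hright : ω (m + 1) b ≤ ω a b / 2 := by
      rcases eq_or_lt_of_le hmb with h | h
      · simp [h, hω.self_eq_zero (hfin b b le_rfl)]
      · have h1 : ω a b / 2 ≤ ω a (m + 1) := by
          by_contra h2
          exact hmax (m + 1) (by omega) (by omega) ⟨by omega, (not_le.1 h2).le⟩
        have h3 := hω (s := a) (u := m + 1) (t := b) (by omega) (by omega)
        have hne : ω a b / 2 ≠ ∞ := ENNReal.div_ne_top (hfin a b (by omega)) two_ne_zero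
        refine (ENNReal.add_le_add_iff_left hne).1 ?_
        calc ω a b / 2 + ω (m + 1) b ≤ ω a (m + 1) + ω (m + 1) b := by gcongr
          _ ≤ ω a b := h3
          _ = _ := (ENNReal.add_halves _).symm
    have hsum : ∑ i ∈ Finset.Ico a b, F i (i + 1) =
        ∑ i ∈ Finset.Ico a m, F i (i + 1) + F m (m + 1) +
          ∑ i ∈ Finset.Ico (m + 1) b, F i (i + 1) := by
      rw [← Finset.sum_Ico_succ_top (f := fun i => F i (i + 1)) ham,
        Finset.sum_Ico_consecutive _ (by omega) hmb]
    have hdecomp : F a b - ∑ i ∈ Finset.Ico a b, F i (i + 1) =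
        ((F a b - F a m - F m b) + (F m b - F m (m + 1) - F (m + 1) b)) +
          ((F a m - ∑ i ∈ Finset.Ico a m, F i (i + 1)) +
            (F (m + 1) b - ∑ i ∈ Finset.Ico (m + 1) b, F i (i + 1))) := by
      rw [hsum]; abel
    have hl := ih (m - a) (by omega) a m (by omega)
    have hr := ih (b - (m + 1)) (by omega) (m + 1) b (by omega)
    have hθ0 : (0 : ℝ) ≤ θ := by linarith
    rw [hdecomp]
    refine (enorm_add_le _ _).trans (le_trans (add_le_add
      ((enorm_add_le _ _).trans (add_le_add (hdef a m b ham (by omega))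
        ((hdef m (m + 1) b (by omega) hmb).trans
          (mul_le_mul_right (ENNReal.rpow_le_rpow (hω.mono ham (by omega) le_rfl) hθ0) A))))
      ((enorm_add_le _ _).trans (add_le_add
        (hl.trans (mul_le_mul_right (ENNReal.rpow_le_rpow hPm.2 hθ0) _))
        (hr.trans (mul_le_mul_right (ENNReal.rpow_le_rpow hright hθ0) _))))) ?_)
    rw [← two_mul, ← two_mul]
    exact hK A _

/-! ### Partitions of `[0, T]` -/

section Partitions

variable {T : ℝ}

theorem exists_partition_of_mesh {s t : Set.Icc (0 : ℝ) T} (hst : s ≤ t) {δ : ℝ} (hδ : 0 < δ) :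
    ∃ (N : ℕ) (u : ℕ → Set.Icc (0 : ℝ) T), Monotone u ∧ u 0 = s ∧ u N = t ∧
      ∀ i, (u (i + 1) : ℝ) - u i ≤ δ := by
  obtain ⟨N, hN⟩ := exists_nat_ge (((t : ℝ) - s) / δ)
  have hst' : (s : ℝ) ≤ t := hst
  refine ⟨N, fun i => ⟨min ((s : ℝ) + i * δ) t,
    le_min (add_nonneg s.2.1 (by positivity)) t.2.1, (min_le_right _ _).trans t.2.2⟩, ?_, ?_, ?_, ?_⟩
  · intro i j hij
    have : (i : ℝ) ≤ j := by exact_mod_cast hij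
    rw [← Subtype.coe_le_coe]
    dsimp only
    gcongr
  · ext; simpa using hst'
  · ext
    rw [div_le_iff₀ hδ] at hN
    simp only [inf_eq_right]
    linarith
  · intro i
    push_cast
    rcases min_cases ((s : ℝ) + i * δ) t with h | h <;>
    rcases min_cases ((s : ℝ) + (i + 1) * δ) t with h' | h' <;> linarith [h.1, h.2, h'.1, h'.2]

/-- The sum over a chain that need not start at `0` or end at `T` is at most the variation: the
two end points can be added. -/
theorem sum_chain_le_variation {E : Type*} [NormedAddCommGroup E] (q : ℝ) (F : Triangle T → E)
    {u : ℕ → Set.Icc (0 : ℝ) T} (hu : Monotone u) (n : ℕ) :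
    ∑ i ∈ Finset.range n, ‖F (Triangle.mk (u i) (u (i + 1)) (hu (Nat.le_succ i)))‖ₑ ^ q ≤
      variation q F := by
  have hT : 0 ≤ T := (u 0).2.1.trans (u 0).2.2
  let D : Subdivision T :=
    { n := n + 2
      pt := fun i => if i = 0 then ⟨0, le_rfl, hT⟩ else
        if i ≤ n + 1 then u (i - 1) else ⟨T, hT, le_rfl⟩
      mono := by
        intro i j hij
        dsimp only
        split_ifs with h₁ h₂ h₃ h₄ h₅ h₆
        all_goals first
          | exact le_rfl
          | omega
          | exact (u _).2.1
          | exact (u _).2.2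
          | exact hu (by omega)
      pt_zero := by simp
      pt_last := by simp }
  refine le_trans ?_ (le_iSup (fun D : Subdivision T =>
    ∑ i ∈ Finset.range D.n, ‖F (D.interval i)‖ₑ ^ q) D)
  change _ ≤ ∑ i ∈ Finset.range (n + 2), ‖F (D.interval i)‖ₑ ^ q
  rw [Finset.sum_range_succ', Finset.sum_range_succ]
  refine le_trans (Finset.sum_le_sum fun i hi => ?_) (le_self_add.trans le_self_add)
  have hi := Finset.mem_range.1 hi
  have : D.interval (i + 1) = Triangle.mk (u i) (u (i + 1)) (hu (Nat.le_succ i)) := by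
    apply Subtype.ext
    refine Prod.ext ?_ ?_
    · simp only [Subdivision.interval, D]
      rw [if_neg (by omega), if_pos (by omega)]
      simp
    · simp only [Subdivision.interval, D]
      rw [if_neg (by omega), if_pos (by omega)]
      simp
  rw [this]

end Partitions

namespace RoughPath

variable {d : ℕ} {p T : ℝ}

/-! ### Coordinates of rough paths -/

/-- The coordinate `X_{s,t}^w`, with junk value `0` unless `s ≤ t`. -/
noncomputable def coord (X : RoughPath d p T) (w : Word d) (s t : Set.Icc (0 : ℝ) T) : ℝ :=
  if h : s ≤ t then X.toFun (Triangle.mk s t h) w else 0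

theorem coord_of_le (X : RoughPath d p T) (w : Word d) {s t : Set.Icc (0 : ℝ) T} (h : s ≤ t) :
    X.coord w s t = X.toFun (Triangle.mk s t h) w := dif_pos h

theorem coord_nil (X : RoughPath d p T) {s t : Set.Icc (0 : ℝ) T} (h : s ≤ t) :
    X.coord [] s t = 1 := by rw [coord_of_le X _ h, X.zeroth]

/-- Chen's identity, isolating the two extreme terms. -/
theorem coord_defect (X : RoughPath d p T) {w : Word d} (hw : 1 ≤ w.length)
    {s u t : Set.Icc (0 : ℝ) T} (hsu : s ≤ u) (hut : u ≤ t) :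
    X.coord w s t - X.coord w s u - X.coord w u t =
      ∑ i ∈ Finset.Ico 1 w.length, X.coord (w.take i) s u * X.coord (w.drop i) u t := by
  have h : X.coord w s t =
      ∑ i ∈ Finset.range (w.length + 1), X.coord (w.take i) s u * X.coord (w.drop i) u t := by
    simp only [coord_of_le X _ (hsu.trans hut), coord_of_le X _ hsu, coord_of_le X _ hut,
      X.chen s u t hsu hut, TensorSeries.tmul]
  rw [h, Finset.range_eq_Ico, Finset.sum_Ico_succ_top (Nat.zero_le _),
    Finset.sum_eq_sum_Ico_succ_bot hw]
  simp only [List.take_zero, List.drop_zero, List.take_length, List.drop_length, coord_nil X hsu,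
    coord_nil X hut]
  ring

theorem coord_self (X : RoughPath d p T) (s : Set.Icc (0 : ℝ) T) :
    ∀ {w : Word d}, 1 ≤ w.length → X.coord w s s = 0 := by
  intro w
  induction hn : w.length using Nat.strong_induction_on generalizing w with
  | _ n ih =>
    intro hw
    have h := X.coord_defect (w := w) (by omega) (le_refl s) (le_refl s)
    rw [Finset.sum_eq_zero] at h
    · linarith
    · intro i hi
      rw [Finset.mem_Ico] at hi
      have hl : (w.take i).length = i := by rw [List.length_take]; omega
      rw [ih i (by omega) hl hi.1, zero_mul]

theorem enorm_apply_sub_le_level (a b : TensorSeries d) (w : Word d) :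
    ‖a w - b w‖ₑ ≤ ‖a.level w.length - b.level w.length‖ₑ := by
  have h := PiLp.norm_apply_le (a.level w.length - b.level w.length) w.get
  simp only [PiLp.sub_apply, TensorSeries.level, List.ofFn_get] at h
  rw [← ofReal_norm, ← ofReal_norm]
  exact ENNReal.ofReal_le_ofReal h

theorem norm_apply_le_level (a : TensorSeries d) (w : Word d) :
    ‖a w‖ ≤ ‖a.level w.length‖ := by
  have h := PiLp.norm_apply_le (a.level w.length) w.get
  simpa only [TensorSeries.level, List.ofFn_get] using h

theorem enorm_coord_le_level (X : RoughPath d p T) (w : Word d) {s t : Set.Icc (0 : ℝ) T}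
    (h : s ≤ t) : ‖X.coord w s t‖ₑ ≤ ‖(X.toFun (Triangle.mk s t h)).level w.length‖ₑ := by
  rw [coord_of_le X w h, ← ofReal_norm, ← ofReal_norm]
  exact ENNReal.ofReal_le_ofReal (norm_apply_le_level _ w)

/-- By uniform continuity, the increments over short intervals are uniformly small. -/
theorem eventually_forall_coord_le (X : RoughPath d p T) {w : Word d} (hw : 1 ≤ w.length)
    {ε : ℝ} (hε : 0 < ε) :
    ∀ᶠ δ : ℝ in 𝓝[>] 0, ∀ s t : Set.Icc (0 : ℝ) T, s ≤ t → (t : ℝ) - s ≤ δ →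
      ‖X.coord w s t‖ ≤ ε := by
  have hclosed : IsClosed {q : Set.Icc (0 : ℝ) T × Set.Icc (0 : ℝ) T | q.1 ≤ q.2} :=
    isClosed_le continuous_fst continuous_snd
  have : CompactSpace (Triangle T) := isCompact_iff_compactSpace.1 hclosed.isCompact
  have hcont : Continuous fun q => X.toFun q w := (continuous_apply w).comp X.continuous_toFun
  obtain ⟨δ, hδ, h⟩ := Metric.uniformContinuous_iff.1
    (CompactSpace.uniformContinuous_of_continuous hcont) ε hε
  filter_upwards [Ioo_mem_nhdsGT hδ] with δ' hδ' s t hst hd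
  have hst' : (s : ℝ) ≤ t := hst
  have := h (a := Triangle.mk s t hst) (b := Triangle.mk s s le_rfl) (by
    rw [Subtype.dist_eq, Prod.dist_eq]
    simp only [dist_self]
    rw [Subtype.dist_eq, Real.dist_eq, abs_of_nonneg (by linarith)]
    exact max_lt hδ (hd.trans_lt hδ'.2))
  rw [← coord_of_le X w hst, ← coord_of_le X w le_rfl, X.coord_self s hw, dist_zero_right] at this
  exact this.le

/-! ### Levels above `p` are controlled by the levels up to `p` -/

/-- A coordinate of level above `p` has arbitrarily small sums along fine partitions, because its
`p/k`-variation is finite and `p/k < 1`. -/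
theorem exists_partition_sum_le (hp : 0 < p) (X : RoughPath d p T) {w : Word d}
    (hw : p < w.length) {s t : Set.Icc (0 : ℝ) T} (hst : s ≤ t) {η : ℝ≥0∞} (hη : 0 < η) :
    ∃ (N : ℕ) (u : ℕ → Set.Icc (0 : ℝ) T), Monotone u ∧ u 0 = s ∧ u N = t ∧
      ∑ i ∈ Finset.range N, ‖X.coord w (u i) (u (i + 1))‖ₑ ≤ η := by
  have hw0 : (0 : ℝ) < w.length := hp.trans hw
  have hw1 : 1 ≤ w.length := by exact_mod_cast hw0
  set V := variation (p / w.length) (fun q => (X.toFun q).level w.length) with hV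
  have hVfin : V ≠ ∞ := (X.finite_variation _ hw1).ne
  have hq : 0 < 1 - p / w.length := by
    rw [sub_pos, div_lt_one hw0]; exact hw
  obtain ⟨ε, hεη, hε⟩ : ∃ ε : ℝ, ENNReal.ofReal ε ^ (1 - p / w.length) * V ≤ η ∧ 0 < ε := by
    have h1 : Tendsto (fun ε : ℝ => ENNReal.ofReal ε ^ (1 - p / w.length) * V) (𝓝[>] 0)
        (𝓝 0) := by
      have h2 : Tendsto (fun ε : ℝ => ENNReal.ofReal ε ^ (1 - p / w.length) * V) (𝓝 0)
          (𝓝 (ENNReal.ofReal 0 ^ (1 - p / w.length) * V)) := by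
        refine ENNReal.Tendsto.mul_const ?_ (Or.inr hVfin)
        exact ((ENNReal.continuous_rpow_const.comp ENNReal.continuous_ofReal).tendsto 0)
      rw [ENNReal.ofReal_zero, ENNReal.zero_rpow_of_pos hq, zero_mul] at h2
      exact h2.mono_left nhdsWithin_le_nhds
    exact ((h1.eventually (ge_mem_nhds hη)).and self_mem_nhdsWithin).exists
  obtain ⟨δ, hδ, hδ0⟩ := ((X.eventually_forall_coord_le hw1 hε).and self_mem_nhdsWithin).exists
  obtain ⟨N, u, hu, hu0, huN, hmesh⟩ := exists_partition_of_mesh hst hδ0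
  refine ⟨N, u, hu, hu0, huN, le_trans ?_ hεη⟩
  refine le_trans (Finset.sum_le_sum fun i _ => ?_)
    ((Finset.mul_sum _ _ _).symm.le.trans (mul_le_mul_right (sum_chain_le_variation _ _ hu N) _))
  have hi := hu (Nat.le_succ i)
  have hsmall : ‖X.coord w (u i) (u (i + 1))‖ₑ ≤ ENNReal.ofReal ε := by
    rw [← ofReal_norm]
    exact ENNReal.ofReal_le_ofReal (hδ _ _ hi (hmesh i))
  calc ‖X.coord w (u i) (u (i + 1))‖ₑ
      = ‖X.coord w (u i) (u (i + 1))‖ₑ ^ (1 - p / w.length) *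
          ‖X.coord w (u i) (u (i + 1))‖ₑ ^ (p / w.length) := by
        rw [← ENNReal.rpow_add_of_nonneg _ _ hq.le (by positivity)]
        simp
    _ ≤ _ := by
        gcongr
        exact X.enorm_coord_le_level w hi

/-- **Lyons' extension estimate.** If the levels up to `n` are bounded by `ω^{k/p'}` for a control
`ω` on `[a, b]`, with `p < p' < n + 1`, then so are all levels, with constants that depend neither
on the path nor on the control. -/
theorem exists_extension_const (hp : 0 < p) {p' : ℝ} (hpp' : p < p') {n : ℕ}
    (hp'n : p' < n + 1) (k : ℕ) :
    ∃ C : ℝ≥0, ∀ (Y : RoughPath d p T) (a b : Set.Icc (0 : ℝ) T)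
      (ω : Set.Icc (0 : ℝ) T → Set.Icc (0 : ℝ) T → ℝ≥0∞), Superadditive ω →
      (∀ s t, s ≤ t → ω s t ≠ ∞) →
      (∀ v : Word d, 1 ≤ v.length → v.length ≤ n → ∀ s t, a ≤ s → s ≤ t → t ≤ b →
        ‖Y.coord v s t‖ₑ ≤ ω s t ^ (v.length / p')) →
      ∀ v : Word d, 1 ≤ v.length → v.length ≤ k → ∀ s t, a ≤ s → s ≤ t → t ≤ b →
        ‖Y.coord v s t‖ₑ ≤ C * ω s t ^ (v.length / p') := by
  have hp'0 : 0 < p' := hp.trans hpp'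
  induction k with
  | zero => exact ⟨0, fun Y a b ω _ _ _ v h1 h2 => by omega⟩
  | succ k ih =>
    obtain ⟨C, hC⟩ := ih
    by_cases hkn : k + 1 ≤ n
    · refine ⟨1, fun Y a b ω _ _ hY v hv1 hvk s t has hst htb => ?_⟩
      simpa using hY v hv1 (by omega) s t has hst htb
    have hθ : 1 < ((k + 1 : ℕ) : ℝ) / p' := by
      rw [one_lt_div hp'0]
      refine hp'n.trans_le ?_
      have : n + 1 ≤ k + 1 := by omega
      exact_mod_cast this
    obtain ⟨K, hK⟩ := exists_sewing_const hθ
    refine ⟨max C (K * (k * C * C)), fun Y a b ω hω hfin hY v hv1 hvk s t has hst htb => ?_⟩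
    have hC' := hC Y a b ω hω hfin hY
    rcases Nat.lt_or_ge v.length (k + 1) with hlt | hge
    · refine (hC' v hv1 (by omega) s t has hst htb).trans ?_
      gcongr
      exact le_max_left _ _
    have hvk : v.length = k + 1 := by omega
    have hdef (s u t) (has : a ≤ s) (hsu : s ≤ u) (hut : u ≤ t) (htb : t ≤ b) :
        ‖Y.coord v s t - Y.coord v s u - Y.coord v u t‖ₑ ≤
          (k * C * C : ℝ≥0) * ω s t ^ (((k + 1 : ℕ) : ℝ) / p') := by
      rw [Y.coord_defect hv1 hsu hut]
      refine (enorm_sum_le _ _).trans ((Finset.sum_le_card_nsmul _ _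
        (C * C * ω s t ^ (((k + 1 : ℕ) : ℝ) / p')) fun i hi => ?_).trans (le_of_eq ?_))
      · rw [Finset.mem_Ico] at hi
        have h1 : (v.take i).length = i := by rw [List.length_take]; omega
        have h2 : (v.drop i).length = k + 1 - i := by rw [List.length_drop]; omega
        have b1 := hC' (v.take i) (by omega) (by omega) s u has hsu (hut.trans htb)
        have b2 := hC' (v.drop i) (by omega) (by omega) u t (has.trans hsu) hut htb
        rw [h1] at b1
        rw [h2] at b2
        have hexp : ((k + 1 : ℕ) : ℝ) / p' = (i : ℝ) / p' + ((k + 1 - i : ℕ) : ℝ) / p' := by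
          rw [← add_div, ← Nat.cast_add]
          congr 2
          omega
        rw [enorm_mul, hexp, ENNReal.rpow_add_of_nonneg _ _ (by positivity) (by positivity)]
        calc _ ≤ (C * ω s u ^ ((i : ℝ) / p')) * (C * ω u t ^ (((k + 1 - i : ℕ) : ℝ) / p')) := by
              gcongr
          _ ≤ (C * ω s t ^ ((i : ℝ) / p')) * (C * ω s t ^ (((k + 1 - i : ℕ) : ℝ) / p')) := by
              gcongr
              · exact hω.mono le_rfl hsu hut
              · exact hω.mono hsu hut le_rfl
          _ = _ := by ring
      · rw [Nat.card_Ico, hvk, Nat.add_sub_cancel, nsmul_eq_mul]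
        push_cast
        ring
    have hmain : ‖Y.coord v s t‖ₑ ≤
        K * (k * C * C : ℝ≥0) * ω s t ^ (((k + 1 : ℕ) : ℝ) / p') := by
      refine ENNReal.le_of_forall_pos_le_add fun η hη _ => ?_
      have hpv : p < v.length := by
        rw [hvk]; exact (hpp'.trans ((one_lt_div hp'0).1 hθ))
      obtain ⟨N, u, hu, hu0, huN, hsum⟩ := Y.exists_partition_sum_le hp hpv hst
        (η := η) (by exact_mod_cast hη)
      -- Beyond the index `N` the chain may leave `[a, b]`, so it is stopped there.
      have hu' : Monotone fun i => u (min i N) := fun i j hij => hu (min_le_min_right N hij)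
      have hN (i : ℕ) : u (min i N) ≤ b :=
        (hu (min_le_right i N)).trans (huN.le.trans htb)
      have h0 (i : ℕ) : a ≤ u (min i N) := has.trans (hu0.symm.le.trans (hu (Nat.zero_le _)))
      have hsew := enorm_sub_sum_le hθ hK
        (F := fun i j => Y.coord v (u (min i N)) (u (min j N)))
        (ω := fun i j => ω (u (min i N)) (u (min j N)))
        (fun i j l hij hjl => hω (hu' hij) (hu' hjl)) (fun i j hij => hfin _ _ (hu' hij))
        (fun i => Y.coord_self _ hv1)
        (fun i j l hij hjl => hdef _ _ _ (h0 i) (hu' hij) (hu' hjl) (hN l)) N 0 N (by simp)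
      have hs : ∑ i ∈ Finset.Ico 0 N, Y.coord v (u (min i N)) (u (min (i + 1) N)) =
          ∑ i ∈ Finset.range N, Y.coord v (u i) (u (i + 1)) := by
        rw [← Finset.range_eq_Ico]
        refine Finset.sum_congr rfl fun i hi => ?_
        have := Finset.mem_range.1 hi
        rw [min_eq_left (by omega), min_eq_left (by omega)]
      rw [hs, min_self, Nat.zero_min, hu0, huN] at hsew
      calc ‖Y.coord v s t‖ₑ = ‖(Y.coord v s t - ∑ i ∈ Finset.range N, Y.coord v (u i) (u (i + 1)))
              + ∑ i ∈ Finset.range N, Y.coord v (u i) (u (i + 1))‖ₑ := by rw [sub_add_cancel]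
        _ ≤ _ := (enorm_add_le _ _).trans
          (add_le_add hsew ((enorm_sum_le _ _).trans hsum))
    rw [hvk]
    refine hmain.trans ?_
    gcongr
    exact_mod_cast le_max_right _ _

/-! ### The `p`-variation control and its dependence on the path -/

/-- `‖X^k_{s,t}‖`, with junk value `0` unless `s ≤ t`. -/
noncomputable def levelNorm (X : RoughPath d p T) (k : ℕ) (s t : Set.Icc (0 : ℝ) T) : ℝ≥0∞ :=
  if h : s ≤ t then ‖(X.toFun (Triangle.mk s t h)).level k‖ₑ else 0

/-- The `p`-variation control of a rough path: the smallest control that dominates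
`∑_{k ≤ ⌊p⌋} ‖X^k_{s,t}‖^{p/k}`. -/
noncomputable def control (X : RoughPath d p T) :
    Set.Icc (0 : ℝ) T → Set.Icc (0 : ℝ) T → ℝ≥0∞ :=
  chainSup fun s t => ∑ k ∈ Finset.Icc 1 ⌊p⌋₊, X.levelNorm k s t ^ (p / k)

/-- The sum of the variations of the levels up to `⌊p⌋`. -/
noncomputable def totalVariation (X : RoughPath d p T) : ℝ≥0∞ :=
  ∑ k ∈ Finset.Icc 1 ⌊p⌋₊, variation (p / k) fun q => (X.toFun q).level k

theorem totalVariation_ne_top (X : RoughPath d p T) : X.totalVariation ≠ ∞ :=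
  ENNReal.sum_ne_top.2 fun k hk => (X.finite_variation k (Finset.mem_Icc.1 hk).1).ne

theorem control_le_totalVariation (X : RoughPath d p T) (s t : Set.Icc (0 : ℝ) T) :
    X.control s t ≤ X.totalVariation := by
  refine iSup_le ?_
  rintro ⟨⟨n, u⟩, hu, -, -⟩
  rw [Finset.sum_comm]
  refine Finset.sum_le_sum fun k _ => le_trans (le_of_eq ?_) (sum_chain_le_variation _ _ hu n)
  refine Finset.sum_congr rfl fun i _ => ?_
  rw [levelNorm, dif_pos (hu (Nat.le_succ i))]

theorem enorm_coord_le_control (hp : 0 < p) (X : RoughPath d p T) {v : Word d}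
    (hv1 : 1 ≤ v.length) (hvp : v.length ≤ ⌊p⌋₊) {s t : Set.Icc (0 : ℝ) T} (hst : s ≤ t) :
    ‖X.coord v s t‖ₑ ≤ X.control s t ^ (v.length / p) := by
  have hv0 : (0 : ℝ) < v.length := by exact_mod_cast hv1
  have h : ‖X.coord v s t‖ₑ ^ (p / v.length) ≤ X.control s t := by
    refine le_trans ?_ (le_chainSup _ hst)
    refine le_trans ?_ (Finset.single_le_sum (f := fun k : ℕ => X.levelNorm k s t ^ (p / k))
      (fun _ _ => zero_le) (Finset.mem_Icc.2 ⟨hv1, hvp⟩))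
    rw [levelNorm, dif_pos hst]
    gcongr
    exact X.enorm_coord_le_level v hst
  rw [← inv_div, ENNReal.le_rpow_inv_iff (by positivity)]
  exact h

section

variable [Fact (1 ≤ p)]

theorem variation_sub_le (X Y : RoughPath d p T) {k : ℕ} (hk1 : 1 ≤ k) (hkp : k ≤ ⌊p⌋₊) :
    variation (p / k) (fun q => (Y.toFun q).level k - (X.toFun q).level k) ≤ edist Y X ^ p := by
  have hp : 0 < p := by linarith [(Fact.out : 1 ≤ p)]
  rw [← ENNReal.rpow_inv_le_iff hp, ← one_div]
  exact le_iSup₂ (f := fun (k : ℕ) (_ : k ∈ Finset.Icc 1 ⌊p⌋₊) =>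
    (variation (p / k) (fun q => (Y.toFun q).level k - (X.toFun q).level k)) ^ (1 / p)) k
    (Finset.mem_Icc.2 ⟨hk1, hkp⟩)

/-- Up to level `⌊p⌋`, convergence in `p`-variation is uniform in `(s, t)`. -/
theorem enorm_coord_sub_le (X Y : RoughPath d p T) {w : Word d} (hw1 : 1 ≤ w.length)
    (hwp : w.length ≤ ⌊p⌋₊) {s t : Set.Icc (0 : ℝ) T} (hst : s ≤ t) :
    ‖Y.coord w s t - X.coord w s t‖ₑ ≤ edist Y X ^ (w.length : ℝ) := by
  have hp : 0 < p := by linarith [(Fact.out : 1 ≤ p)]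
  have hw0 : (0 : ℝ) < w.length := by exact_mod_cast hw1
  have hu : Monotone fun i : ℕ => if i = 0 then s else t := by
    intro i j hij
    dsimp only
    split_ifs <;> first | exact le_rfl | exact hst | omega
  have h := (sum_chain_le_variation (p / w.length)
    (fun q => (Y.toFun q).level w.length - (X.toFun q).level w.length) hu 1).trans
    (X.variation_sub_le Y hw1 hwp)
  simp only [Finset.sum_range_one, if_true, zero_add, one_ne_zero, if_false] at h
  rw [coord_of_le Y w hst, coord_of_le X w hst]
  have h2 := (ENNReal.rpow_le_rpow (enorm_apply_sub_le_level _ _ w)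
    (div_pos hp hw0).le).trans h
  rw [← ENNReal.le_rpow_inv_iff (by positivity), ← ENNReal.rpow_mul, inv_div,
    mul_div_cancel₀ _ hp.ne'] at h2
  exact h2

theorem exists_totalVariation_le (X : RoughPath d p T) :
    ∃ M : ℝ≥0∞, M ≠ ∞ ∧ ∀ Y : RoughPath d p T, edist Y X ≤ 1 → Y.totalVariation ≤ M := by
  have hp : 0 < p := by linarith [(Fact.out : 1 ≤ p)]
  refine ⟨∑ k ∈ Finset.Icc 1 ⌊p⌋₊,
    (1 + (variation (p / k) fun q => (X.toFun q).level k) ^ (1 / (p / k))) ^ (p / k), ?_, ?_⟩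
  · refine ENNReal.sum_ne_top.2 fun k hk => ?_
    have hk0 : (0 : ℝ) < k := by exact_mod_cast (Finset.mem_Icc.1 hk).1
    refine ENNReal.rpow_ne_top_of_nonneg (by positivity) (ENNReal.add_ne_top.2
      ⟨ENNReal.one_ne_top, ENNReal.rpow_ne_top_of_nonneg (by positivity)
        (X.finite_variation k (Finset.mem_Icc.1 hk).1).ne⟩)
  · intro Y hY
    refine Finset.sum_le_sum fun k hk => ?_
    obtain ⟨hk1, hkp⟩ := Finset.mem_Icc.1 hk
    have hk0 : (0 : ℝ) < k := by exact_mod_cast hk1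
    have hq : 1 ≤ p / k := (one_le_div hk0).2 ((Nat.cast_le.2 hkp).trans (Nat.floor_le hp.le))
    have h := variation_add_rpow_le hq
      (fun q => (Y.toFun q).level k - (X.toFun q).level k) (fun q => (X.toFun q).level k)
    simp only [sub_add_cancel] at h
    rw [one_div, ENNReal.rpow_inv_le_iff (by positivity), ← one_div] at h
    refine h.trans ?_
    gcongr
    refine ENNReal.rpow_le_one ((X.variation_sub_le Y hk1 hkp).trans ?_) (by positivity)
    exact ENNReal.rpow_le_one hY hp.le

/-! ### Continuity of the coordinates in the `p`-variation metric -/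

/-- The sums of a coordinate of level above `p` along a fine partition are small, uniformly over a
neighbourhood of `X`. On short intervals the levels up to `⌊p⌋` are at most `η^k`, so that they are
bounded by `(η^{p'-p} ω)^{k/p'}` with `ω` the `p`-variation control, and the extension estimate
carries the small factor `η^{p'-p}` to the higher levels. -/
theorem exists_partition_forall_near_sum_le (X : RoughPath d p T) {w : Word d}
    (hw : ⌊p⌋₊ < w.length) {s t : Set.Icc (0 : ℝ) T} (hst : s ≤ t) {ε : ℝ≥0∞} (hε : 0 < ε) :
    ∃ (N : ℕ) (u : ℕ → Set.Icc (0 : ℝ) T), Monotone u ∧ u 0 = s ∧ u N = t ∧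
      ∀ᶠ Y in 𝓝 X, ∑ i ∈ Finset.range N, ‖Y.coord w (u i) (u (i + 1))‖ₑ ≤ ε := by
  have hp : 0 < p := by linarith [(Fact.out : 1 ≤ p)]
  set n := ⌊p⌋₊ with hn
  have hpn : p < n + 1 := Nat.lt_floor_add_one p
  obtain ⟨p', hpp', hp'n⟩ := exists_between hpn
  have hp' : 0 < p' := hp.trans hpp'
  have hθ : 1 ≤ (w.length : ℝ) / p' := by
    rw [one_le_div hp']
    refine hp'n.le.trans ?_
    exact_mod_cast hw
  obtain ⟨C, hC⟩ := exists_extension_const (d := d) (T := T) hp hpp' hp'n w.length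
  obtain ⟨M, hM, hMY⟩ := X.exists_totalVariation_le
  obtain ⟨η, hηε, hη⟩ : ∃ η : ℝ,
      C * (ENNReal.ofReal η ^ (p' - p) * M) ^ (w.length / p') ≤ ε ∧ η ∈ Set.Ioo (0 : ℝ) 1 := by
    have h1 : Tendsto (fun η : ℝ => C * (ENNReal.ofReal η ^ (p' - p) * M) ^ (w.length / p'))
        (𝓝 0) (𝓝 (C * (ENNReal.ofReal 0 ^ (p' - p) * M) ^ (w.length / p'))) := by
      refine ENNReal.Tendsto.const_mul ?_ (Or.inr ENNReal.coe_ne_top)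
      refine (ENNReal.continuous_rpow_const.tendsto _).comp ?_
      refine ENNReal.Tendsto.mul_const ?_ (Or.inr hM)
      exact (ENNReal.continuous_rpow_const.comp ENNReal.continuous_ofReal).tendsto 0
    rw [ENNReal.ofReal_zero, ENNReal.zero_rpow_of_pos (by linarith), zero_mul,
      ENNReal.zero_rpow_of_pos (by linarith), mul_zero] at h1
    exact (((h1.mono_left (nhdsWithin_le_nhds (s := Set.Ioi 0))).eventually
      (ge_mem_nhds hε)).and (Ioo_mem_nhdsGT one_pos)).exists
  have hη0 := hη.1
  set ε₀ : ℝ := η ^ n / 2 with hε₀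
  have hε₀pos : 0 < ε₀ := by positivity
  have hε₀le : ε₀ ≤ 1 := by
    have : η ^ n ≤ 1 := pow_le_one₀ hη0.le hη.2.le
    linarith
  have hmeshes : ∀ᶠ δ : ℝ in 𝓝[>] 0, ∀ v ∈ {v : Word d | v.length ≤ n}, 1 ≤ v.length →
      ∀ s t : Set.Icc (0 : ℝ) T, s ≤ t → (t : ℝ) - s ≤ δ → ‖X.coord v s t‖ ≤ ε₀ := by
    rw [eventually_all_finite (List.finite_length_le (Fin (d + 1)) n)]
    intro v _
    by_cases hv : 1 ≤ v.length
    · simpa [hv] using X.eventually_forall_coord_le hv hε₀pos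
    · simp [hv]
  obtain ⟨δ, hδ, hδ0⟩ := (hmeshes.and self_mem_nhdsWithin).exists
  obtain ⟨N, u, hu, hu0, huN, hmesh⟩ := exists_partition_of_mesh hst hδ0
  refine ⟨N, u, hu, hu0, huN, ?_⟩
  have hnear : ∀ᶠ Y in 𝓝 X, edist Y X ≤ ENNReal.ofReal ε₀ :=
    (tendsto_id.edist tendsto_const_nhds : Tendsto (fun Y => edist Y X) (𝓝 X)
      (𝓝 (edist X X))).eventually (ge_mem_nhds (by simpa using hε₀pos))
  filter_upwards [hnear] with Y hY
  have hY1 : edist Y X ≤ 1 := hY.trans (by simpa using hε₀le)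
  set ω : Set.Icc (0 : ℝ) T → Set.Icc (0 : ℝ) T → ℝ≥0∞ :=
    fun s t => ENNReal.ofReal η ^ (p' - p) * Y.control s t with hωdef
  have hη_top : ENNReal.ofReal η ^ (p' - p) ≠ ∞ :=
    ENNReal.rpow_ne_top_of_nonneg (by linarith) ENNReal.ofReal_ne_top
  have hω : Superadditive ω := (superadditive_chainSup _).const_mul _
  have hωfin (s t) : ω s t ≠ ∞ := ENNReal.mul_ne_top hη_top
    (ne_top_of_le_ne_top Y.totalVariation_ne_top (Y.control_le_totalVariation s t))
  have hlow (i : ℕ) : ∀ v : Word d, 1 ≤ v.length → v.length ≤ n → ∀ s t, u i ≤ s → s ≤ t →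
      t ≤ u (i + 1) → ‖Y.coord v s t‖ₑ ≤ ω s t ^ (v.length / p') := by
    intro v hv1 hvn s' t' hs' hst' ht'
    have hs'' : (u i : ℝ) ≤ s' := hs'
    have ht'' : (t' : ℝ) ≤ u (i + 1) := ht'
    have hv0 : (0 : ℝ) < v.length := by exact_mod_cast hv1
    have hsmall : ‖Y.coord v s' t'‖ₑ ≤ ENNReal.ofReal η ^ (v.length : ℝ) := by
      have h1 : ‖X.coord v s' t'‖ₑ ≤ ENNReal.ofReal ε₀ := by
        rw [← ofReal_norm]
        exact ENNReal.ofReal_le_ofReal (hδ v hvn hv1 s' t' hst' (by linarith [hmesh i]))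
      have h2 : ‖Y.coord v s' t' - X.coord v s' t'‖ₑ ≤ ENNReal.ofReal ε₀ := by
        refine (X.enorm_coord_sub_le Y hv1 hvn hst').trans (le_trans ?_ hY)
        calc edist Y X ^ (v.length : ℝ) ≤ edist Y X ^ (1 : ℝ) :=
              ENNReal.rpow_le_rpow_of_exponent_ge hY1 (by exact_mod_cast hv1)
          _ = edist Y X := ENNReal.rpow_one _
      calc ‖Y.coord v s' t'‖ₑ
          = ‖(Y.coord v s' t' - X.coord v s' t') + X.coord v s' t'‖ₑ := by rw [sub_add_cancel]
        _ ≤ ENNReal.ofReal ε₀ + ENNReal.ofReal ε₀ := (enorm_add_le _ _).trans (add_le_add h2 h1)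
        _ = ENNReal.ofReal η ^ n := by
          rw [← ENNReal.ofReal_add hε₀pos.le hε₀pos.le, ← ENNReal.ofReal_pow hη0.le]
          congr 1
          rw [hε₀]; ring
        _ ≤ ENNReal.ofReal η ^ v.length :=
          pow_le_pow_of_le_one (zero_le) (by simpa using hη.2.le) hvn
        _ = _ := (ENNReal.rpow_natCast _ _).symm
    -- Interpolate: the exponents `p / p'` and `1 - p / p'` add up to `1`.
    have hpp1 : p / p' < 1 := (div_lt_one hp').2 hpp'
    have hctrl := Y.enorm_coord_le_control hp hv1 hvn hst'
    calc ‖Y.coord v s' t'‖ₑ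
        = ‖Y.coord v s' t'‖ₑ ^ (1 - p / p') * ‖Y.coord v s' t'‖ₑ ^ (p / p') := by
          rw [← ENNReal.rpow_add_of_nonneg _ _ (by linarith) (by positivity), sub_add_cancel,
            ENNReal.rpow_one]
      _ ≤ (ENNReal.ofReal η ^ (v.length : ℝ)) ^ (1 - p / p') *
            (Y.control s' t' ^ (v.length / p)) ^ (p / p') := by
          gcongr
      _ = (ENNReal.ofReal η ^ (p' - p)) ^ (v.length / p') *
            Y.control s' t' ^ (v.length / p') := by
          rw [← ENNReal.rpow_mul, ← ENNReal.rpow_mul, ← ENNReal.rpow_mul]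
          congr 2
          · field_simp
          · field_simp
      _ = _ := (ENNReal.mul_rpow_of_nonneg _ _ (by positivity)).symm
  have hhigh (i : ℕ) : ‖Y.coord w (u i) (u (i + 1))‖ₑ ≤
      C * ω (u i) (u (i + 1)) ^ (w.length / p') :=
    hC Y (u i) (u (i + 1)) ω hω (fun s t _ => hωfin s t) (hlow i) w (by omega) le_rfl _ _ le_rfl
      (hu (Nat.le_succ i)) le_rfl
  calc _ ≤ ∑ i ∈ Finset.range N, C * ω (u i) (u (i + 1)) ^ (w.length / p') :=
        Finset.sum_le_sum fun i _ => hhigh i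
    _ = C * ∑ i ∈ Finset.range N, ω (u i) (u (i + 1)) ^ (w.length / p') :=
        (Finset.mul_sum _ _ _).symm
    _ ≤ C * ω (u 0) (u N) ^ (w.length / p') := by
        gcongr
        exact hω.sum_rpow_le hθ hu N
    _ ≤ C * (ENNReal.ofReal η ^ (p' - p) * M) ^ (w.length / p') := by
        gcongr
        simp only [hωdef]
        gcongr
        exact (Y.control_le_totalVariation _ _).trans (hMY Y hY1)
    _ ≤ ε := hηε

/-- The additivity defect of a coordinate along a chain is a polynomial in shorter coordinates. -/
theorem continuous_coord_sub_sum {w : Word d} (hw : 1 ≤ w.length)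
    (ih : ∀ v : Word d, v.length < w.length → ∀ s t : Set.Icc (0 : ℝ) T,
      Continuous fun Y : RoughPath d p T => Y.coord v s t)
    {u : ℕ → Set.Icc (0 : ℝ) T} (hu : Monotone u) (N : ℕ) :
    Continuous fun Y : RoughPath d p T =>
      Y.coord w (u 0) (u N) - ∑ i ∈ Finset.range N, Y.coord w (u i) (u (i + 1)) := by
  induction N with
  | zero =>
    simp only [Finset.range_zero, Finset.sum_empty, sub_zero, coord_self _ _ hw]
    exact continuous_const
  | succ N ihN =>
    have h : (fun Y : RoughPath d p T =>
        Y.coord w (u 0) (u (N + 1)) - ∑ i ∈ Finset.range (N + 1), Y.coord w (u i) (u (i + 1))) =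
        fun Y => (Y.coord w (u 0) (u N) - ∑ i ∈ Finset.range N, Y.coord w (u i) (u (i + 1))) +
          ∑ i ∈ Finset.Ico 1 w.length,
            Y.coord (w.take i) (u 0) (u N) * Y.coord (w.drop i) (u N) (u (N + 1)) := by
      funext Y
      rw [← Y.coord_defect hw (hu (Nat.zero_le N)) (hu (Nat.le_succ N)), Finset.sum_range_succ]
      ring
    rw [h]
    refine ihN.add (continuous_finsetSum _ fun i hi => ?_)
    rw [Finset.mem_Ico] at hi
    exact (ih _ (by rw [List.length_take]; omega) _ _).mul
      (ih _ (by rw [List.length_drop]; omega) _ _)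

/-- **Lyons' continuity theorem**: every coordinate, of whatever level, is continuous in the
`p`-variation metric, although the metric involves only the levels up to `⌊p⌋`. -/
theorem continuous_coord (w : Word d) (s t : Set.Icc (0 : ℝ) T) :
    Continuous fun Y : RoughPath d p T => Y.coord w s t := by
  induction hk : w.length using Nat.strong_induction_on generalizing w s t with
  | _ k ih =>
    by_cases hst : s ≤ t
    swap
    · simp only [coord, dif_neg hst]
      exact continuous_const
    rcases Nat.eq_zero_or_pos k with h0 | h0
    · have : w = [] := List.length_eq_zero_iff.1 (hk.trans h0)
      simp only [this, coord_nil _ hst]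
      exact continuous_const
    rw [continuous_iff_continuousAt]
    intro X
    rcases le_or_gt w.length ⌊p⌋₊ with hwp | hwp
    · rw [ContinuousAt, tendsto_iff_edist_tendsto_0]
      have h1 : Tendsto (fun Y : RoughPath d p T => edist Y X ^ (w.length : ℝ)) (𝓝 X) (𝓝 0) := by
        have h2 := (ENNReal.continuous_rpow_const (y := (w.length : ℝ))).tendsto (edist X X)
        rw [edist_self, ENNReal.zero_rpow_of_pos (by rw [hk]; exact_mod_cast h0)] at h2
        refine h2.comp ?_
        have := (tendsto_id.edist tendsto_const_nhds : Tendsto (fun Y => edist Y X) (𝓝 X)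
          (𝓝 (edist X X)))
        rwa [edist_self] at this
      refine tendsto_of_tendsto_of_tendsto_of_le_of_le tendsto_const_nhds h1
        (fun _ => zero_le) fun Y => ?_
      dsimp only
      rw [edist_eq_enorm_sub]
      exact X.enorm_coord_sub_le Y (by omega) hwp hst
    · refine continuousAt_of_locally_uniform_approx_of_continuousAt fun V hV => ?_
      obtain ⟨ε, hε, hεV⟩ := mem_uniformity_edist.1 hV
      obtain ⟨ε', hε', hε'ε⟩ := exists_between hε
      obtain ⟨N, u, hu, hu0, huN, hnear⟩ :=
        X.exists_partition_forall_near_sum_le hwp hst hε'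
      refine ⟨_, hnear, fun Y => Y.coord w s t -
        ∑ i ∈ Finset.range N, Y.coord w (u i) (u (i + 1)), ?_, fun Y hY => hεV ?_⟩
      · have := continuous_coord_sub_sum (p := p) (w := w) (by omega)
          (fun v hv s t => ih v.length (by omega) v s t rfl) hu N
        rw [hu0, huN] at this
        exact this.continuousAt
      · rw [edist_eq_enorm_sub, sub_sub_cancel]
        exact ((enorm_sum_le _ _).trans hY).trans_lt hε'ε

end

end RoughPath

/-! ### Weak convergence and uniformly integrable functions -/

section WeakConvergence

variable {ι E : Type*} [TopologicalSpace E] [MeasurableSpace E] [OpensMeasurableSpace E]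
  {l : Filter ι} [l.NeBot] {ps : ι → ProbabilityMeasure E} {ν : ProbabilityMeasure E}

/-- A uniform bound on the integrals of a nonnegative continuous function, which need not be
bounded, passes to the weak limit. -/
theorem lintegral_le_of_tendsto (h : Tendsto ps l (𝓝 ν)) {g : E → ℝ≥0} (hg : Continuous g)
    {C : ℝ≥0∞} (hC : ∀ i, ∫⁻ x, g x ∂(ps i : Measure E) ≤ C) :
    ∫⁻ x, g x ∂(ν : Measure E) ≤ C := by
  have htrunc (N : ℕ) : ∫⁻ x, ((min (g x) N : ℝ≥0) : ℝ≥0∞) ∂(ν : Measure E) ≤ C := by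
    let b : BoundedContinuousFunction E ℝ≥0 :=
      BoundedContinuousFunction.mkOfBound ⟨fun x => min (g x) N, by fun_prop⟩ N fun x y => by
        change |((min (g x) N : ℝ≥0) : ℝ) - ((min (g y) N : ℝ≥0) : ℝ)| ≤ N
        have h1 : ((min (g x) N : ℝ≥0) : ℝ) ≤ N := by exact_mod_cast min_le_right _ _
        have h2 : ((min (g y) N : ℝ≥0) : ℝ) ≤ N := by exact_mod_cast min_le_right _ _
        rw [abs_le]
        constructor
        · linarith [NNReal.coe_nonneg (min (g x) N)]
        · linarith [NNReal.coe_nonneg (min (g y) N)]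
    refine le_of_tendsto' (ProbabilityMeasure.tendsto_iff_forall_lintegral_tendsto.1 h b)
      fun i => (lintegral_mono fun x => ?_).trans (hC i)
    exact ENNReal.coe_le_coe.2 (min_le_left _ _)
  have hsup (x : E) : (g x : ℝ≥0∞) = ⨆ N : ℕ, ((min (g x) N : ℝ≥0) : ℝ≥0∞) := by
    refine le_antisymm ?_ (iSup_le fun N => ENNReal.coe_le_coe.2 (min_le_left _ _))
    obtain ⟨N, hN⟩ := exists_nat_ge (g x)
    exact le_iSup_of_le N (by rw [min_eq_left hN])
  simp_rw [hsup]
  rw [lintegral_iSup]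
  · exact iSup_le htrunc
  · intro N
    have : Continuous fun x => ((min (g x) N : ℝ≥0) : ℝ≥0∞) := by fun_prop
    exact this.measurable
  · intro N M hNM x
    exact ENNReal.coe_le_coe.2 (min_le_min le_rfl (by exact_mod_cast hNM))

/-- `f` differs from its truncation at height `K` by `(|f| - K)⁺`. -/
theorem abs_sub_truncation (a : ℝ) {K : ℝ} (hK : 0 ≤ K) :
    |a - max (-K) (min a K)| = max (|a| - K) 0 := by
  rcases le_total a K with h | h <;> rcases le_total (-K) a with h' | h' <;>
    rcases le_total 0 a with h0 | h0 <;>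
    simp only [abs_of_nonneg, abs_of_nonpos, h, h0, min_eq_left, min_eq_right] <;> grind

theorem lintegral_excess_le {f h : E → ℝ} (hh : Continuous h) (hfh : ∀ x, |f x| ≤ h x) {K : ℝ}
    (hK : 0 ≤ K) (m : Measure E) :
    ∫⁻ x, ((|f x| - K).toNNReal : ℝ≥0∞) ∂m ≤ ∫⁻ x in {x | K ≤ h x}, ‖h x‖ₑ ∂m := by
  rw [← lintegral_indicator (measurableSet_le measurable_const hh.measurable)]
  refine lintegral_mono fun x => ?_
  by_cases hx : K ≤ h x
  · have h0 : 0 ≤ h x := hK.trans hx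
    rw [Set.indicator_of_mem (by exact hx), Real.enorm_eq_ofReal h0]
    exact ENNReal.ofReal_le_ofReal (by linarith [hfh x])
  · rw [Set.indicator_of_notMem (by exact hx), Real.toNNReal_of_nonpos (by linarith [hfh x])]
    simp

/-- Let `|f| ≤ h` with `f`, `h` continuous and `h` uniformly integrable along `ps`. Then
`f` is integrable under the weak limit and its integrals converge. -/
theorem integrable_and_tendsto_integral (hν : Tendsto ps l (𝓝 ν)) {f h : E → ℝ}
    (hf : Continuous f) (hh : Continuous h) (hfh : ∀ x, |f x| ≤ h x)
    (hint : ∀ i, Integrable f (ps i : Measure E))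
    (hUI : Tendsto (fun K : ℝ => ⨆ i, ∫⁻ x in {x | K ≤ h x}, ‖h x‖ₑ ∂(ps i : Measure E))
      atTop (𝓝 0)) :
    Integrable f (ν : Measure E) ∧
      Tendsto (fun i => ∫ x, f x ∂(ps i : Measure E)) l (𝓝 (∫ x, f x ∂(ν : Measure E))) := by
  have htail {ε : ℝ≥0∞} (hε : 0 < ε) : ∃ K : ℝ, 0 ≤ K ∧
      (∀ i, ∫⁻ x, ((|f x| - K).toNNReal : ℝ≥0∞) ∂(ps i : Measure E) ≤ ε) ∧
      ∫⁻ x, ((|f x| - K).toNNReal : ℝ≥0∞) ∂(ν : Measure E) ≤ ε := by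
    obtain ⟨K, hKε, hK0⟩ := ((hUI.eventually_lt_const hε).and (eventually_ge_atTop 0)).exists
    have h1 i : ∫⁻ x, ((|f x| - K).toNNReal : ℝ≥0∞) ∂(ps i : Measure E) ≤ ε :=
      (lintegral_excess_le hh hfh hK0 _).trans ((le_iSup (fun i =>
        ∫⁻ x in {x | K ≤ h x}, ‖h x‖ₑ ∂(ps i : Measure E)) i).trans hKε.le)
    exact ⟨K, hK0, h1, lintegral_le_of_tendsto hν (by fun_prop) h1⟩
  have hint' : Integrable f (ν : Measure E) := by
    obtain ⟨K, hK0, -, hK⟩ := htail one_pos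
    refine ⟨hf.measurable.aestronglyMeasurable, ?_⟩
    refine lt_of_le_of_lt (b := ∫⁻ x, (((|f x| - K).toNNReal : ℝ≥0∞) + ENNReal.ofReal K)
      ∂(ν : Measure E)) (lintegral_mono fun x => ?_) ?_
    · rw [← ofReal_norm, Real.norm_eq_abs]
      change _ ≤ ENNReal.ofReal _ + _
      calc _ = ENNReal.ofReal (|f x| - K + K) := by rw [sub_add_cancel]
        _ ≤ _ := ENNReal.ofReal_add_le
    · rw [lintegral_add_right _ measurable_const]
      simp only [lintegral_const, measure_univ, mul_one]
      exact ENNReal.add_lt_top.2 ⟨hK.trans_lt ENNReal.one_lt_top, ENNReal.ofReal_lt_top⟩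
  refine ⟨hint', Metric.tendsto_nhds.2 fun ε hε => ?_⟩
  obtain ⟨K, hK0, hKi, hKν⟩ := htail (ε := ENNReal.ofReal (ε / 3)) (by simpa using by positivity)
  let b : BoundedContinuousFunction E ℝ :=
    BoundedContinuousFunction.ofNormedAddCommGroup (fun x => max (-K) (min (f x) K))
      (by fun_prop) K fun x => by
        rw [Real.norm_eq_abs, abs_le]
        exact ⟨le_max_left _ _, max_le (by linarith) (min_le_right _ _)⟩
  have hclose (m : ProbabilityMeasure E) (hm : Integrable f (m : Measure E))
      (hmK : ∫⁻ x, ((|f x| - K).toNNReal : ℝ≥0∞) ∂(m : Measure E) ≤ ENNReal.ofReal (ε / 3)) :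
      dist (∫ x, f x ∂(m : Measure E)) (∫ x, b x ∂(m : Measure E)) ≤ ε / 3 := by
    rw [dist_eq_norm, ← integral_sub hm (b.integrable _)]
    rw [← ENNReal.ofReal_le_ofReal_iff (by positivity), ofReal_norm]
    refine (enorm_integral_le_lintegral_enorm _).trans (le_trans (lintegral_mono fun x => ?_) hmK)
    rw [← ofReal_norm, Real.norm_eq_abs]
    change ENNReal.ofReal |f x - max (-K) (min (f x) K)| ≤ ENNReal.ofReal _
    rw [abs_sub_truncation _ hK0, ENNReal.ofReal_max]
    simp
  filter_upwards [Metric.tendsto_nhds.1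
    (ProbabilityMeasure.tendsto_iff_forall_integral_tendsto.1 hν b) (ε / 3) (by positivity)]
    with i hi
  have h1 := hclose (ps i) (hint i) (hKi i)
  have h2 := hclose ν hint' hKν
  rw [dist_comm] at h2
  have h3 := dist_triangle4 (∫ x, f x ∂(ps i : Measure E)) (∫ x, b x ∂(ps i : Measure E))
    (∫ x, b x ∂(ν : Measure E)) (∫ x, f x ∂(ν : Measure E))
  linarith

end WeakConvergence

/-! ### The space of geometric rough paths and its signature -/

section

variable {d : ℕ} {p T : ℝ} [Fact (1 ≤ p)]

theorem continuous_geom_coord (w : Word d) (q : Triangle T) :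
    Continuous fun X : GeomRoughPath d p T => X.1.toFun q w := by
  have h : Continuous fun X : ↥(geometricRoughPaths d p T) => X.1.coord w q.1.1 q.1.2 :=
    (RoughPath.continuous_coord w q.1.1 q.1.2).comp continuous_subtype_val
  simp only [RoughPath.coord_of_le _ w q.2] at h
  exact h

/-- The `p`-variation distance separates points, because the continuous coordinates do. -/
instance : T2Space (GeomRoughPath d p T) := by
  have : T0Space (GeomRoughPath d p T) := ⟨fun X Y hXY => by
    apply Subtype.ext
    have h : X.1.toFun = Y.1.toFun := by
      funext q w
      exact (hXY.map (continuous_geom_coord w q)).eq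
    cases hX : X.1
    cases hY : Y.1
    rw [hX, hY] at h
    cases h
    rfl⟩
  infer_instance

theorem continuous_sig_level (hT : 0 < T) (m : ℕ) :
    Continuous fun X : GeomRoughPath d p T => (sig hT X).level m :=
  (PiLp.continuous_toLp 2 _).comp
    (continuous_pi fun J => continuous_geom_coord (List.ofFn J) _)

theorem HasSigMoments.integrable_sig {hT : 0 < T} {ν : ProbabilityMeasure (GeomRoughPath d p T)}
    (hν : HasSigMoments hT ν) (w : Word d) :
    Integrable (fun X => sig hT X w) (ν : Measure (GeomRoughPath d p T)) :=
  (hν w.length).mono (continuous_geom_coord w _).measurable.aestronglyMeasurable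
    (ae_of_all _ fun X => RoughPath.norm_apply_le_level (sig hT X) w)

/-- Weak convergence along any filter `l`, not only `atTop`: identifying the cluster points of a
tight sequence needs the case of an ultrafilter, since the topology of weak convergence is not
shown to be metrizable here. -/
theorem hasSigMoments_and_tendsto_expectedSig {hT : 0 < T}
    {μs : ℕ → ProbabilityMeasure (GeomRoughPath d p T)} (hμs : ∀ n, HasSigMoments hT (μs n))
    (hUI : UnifIntegrableSig hT μs) {l : Filter ℕ} [l.NeBot]
    {ν : ProbabilityMeasure (GeomRoughPath d p T)} (hν : Tendsto μs l (𝓝 ν)) :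
    HasSigMoments hT ν ∧
      ∀ w, Tendsto (fun n => expectedSig hT (μs n) w) l (𝓝 (expectedSig hT ν w)) := by
  have hUI' (m : ℕ) : Tendsto (fun K : ℝ => ⨆ n : ℕ,
      ∫⁻ X in {X | K ≤ ‖(sig hT X).level m‖}, ‖‖(sig hT X).level m‖‖ₑ
        ∂(μs n : Measure (GeomRoughPath d p T))) atTop (𝓝 0) := by
    simpa only [enorm_norm] using hUI m
  refine ⟨fun m => ?_, fun w => ?_⟩
  · have h := (integrable_and_tendsto_integral hν (continuous_sig_level hT m).norm
      (continuous_sig_level hT m).norm (fun X => (abs_of_nonneg (norm_nonneg _)).le)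
      (fun n => (hμs n m).norm) (hUI' m)).1
    exact (integrable_norm_iff (continuous_sig_level hT m).aestronglyMeasurable).1 h
  · exact (integrable_and_tendsto_integral hν (continuous_geom_coord w _)
      (continuous_sig_level hT w.length).norm
      (fun X => RoughPath.norm_apply_le_level (sig hT X) w)
      (fun n => (hμs n).integrable_sig w) (hUI' w.length)).2

end

end RoughSig

theorem lemmaC2 (d : ℕ) (p T : ℝ) [Fact (1 ≤ p)] (hT : 0 < T)
    (μs : ℕ → ProbabilityMeasure (RoughSig.GeomRoughPath d p T))
    (hμs : ∀ n, RoughSig.HasSigMoments hT (μs n))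
    (hUI : RoughSig.UnifIntegrableSig hT μs)
    (μ : ProbabilityMeasure (RoughSig.GeomRoughPath d p T)) :
    (Tendsto μs atTop (𝓝 μ) →
      RoughSig.HasSigMoments hT μ ∧
        ∀ w : RoughSig.Word d, Tendsto (fun n => RoughSig.expectedSig hT (μs n) w) atTop
          (𝓝 (RoughSig.expectedSig hT μ w))) ∧
    (IsTightMeasureSet
        (Set.range fun n => (μs n : Measure (RoughSig.GeomRoughPath d p T))) →
      RoughSig.HasSigMoments hT μ →
      RoughSig.CharacterisedByExpectedSig hT μ →
      (∀ w : RoughSig.Word d, Tendsto (fun n => RoughSig.expectedSig hT (μs n) w) atTop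
          (𝓝 (RoughSig.expectedSig hT μ w))) →
      Tendsto μs atTop (𝓝 μ)) := by
  refine ⟨RoughSig.hasSigMoments_and_tendsto_expectedSig hμs hUI, fun htight _ hchar hlim => ?_⟩
  have hcompact : IsCompact (closure (Set.range μs)) := by
    refine isCompact_closure_of_isTightMeasureSet (htight.subset ?_)
    rintro _ ⟨_, ⟨n, rfl⟩, rfl⟩
    exact ⟨n, rfl⟩
  refine hcompact.tendsto_nhds_of_unique_mapClusterPt
    (Eventually.of_forall fun n => subset_closure ⟨n, rfl⟩) fun ν _ hν => ?_
  obtain ⟨U, hU, hUν⟩ := mapClusterPt_iff_ultrafilter.1 hν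
  obtain ⟨hνmom, hνlim⟩ := RoughSig.hasSigMoments_and_tendsto_expectedSig hμs hUI hUν
  refine (hchar ν hνmom (funext fun w => ?_)).symm
  exact tendsto_nhds_unique ((hlim w).mono_left hU) (hνlim w)
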